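/- Let $T$ be a countably infinite set and $\Gamma$ a group of permutations of $T$ all of whose orbits in $T$ are infinite. For a compact metric space $K$ let $\Gamma$ act on $K^T$ by $\tau^\gamma((\omega_t)_{t\in T}) = (\omega_{\gamma(t)})_{t\in T}$, and let $\Pr^\Gamma K^T$ be the set of all $\Gamma$-invariant Borel probability measures on $K^T$. It is regarded, with the vague (weak-$*$) topology, as a convex subset of the dual of $C(K^T)$. A Poulsen simplex is a metrizable Choquet simplex with more than one point whose extreme points are dense in it. Suppose that $(T,\Gamma)$ has the Poulsen property, that is, $\Pr^\Gamma K^T$ is a Poulsen simplex for every compact metric space $K$ with at least two points. Let $K$ be a compact metric space, $\Omega\subseteq K^T$ a closed $\Gamma$-invariant set, and $\Pr^\Gamma\Omega$ the set of all $\mu\in\Pr^\Gamma K^T$ with $\mu(\Omega)=1$. Assume that $\Pr^\Gamma\Omega$ has more than one point. Fix a reference index $v\in T$ and, for $\mu,\nu\in\Pr^\Gamma K^T$, put $$\rho(\mu,\nu) := \inf_{\lambda\in J(\mu,\nu)}\lambda\{(\omega,\eta)\in K^T\times K^T:\ \omega_v\neq\eta_v\},$$ where $J(\mu,\nu)$ is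 the set of all $\Gamma$-invariant probability measures on $K^T\times K^T$ (under the diagonal action) with first marginal $\mu$ and second marginal $\nu$. Assume that around $\Pr^\Gamma\Omega$ the neighbourhood bases of the vague topology and of $\rho$ are equivalent: every vaguely open subset of $\Pr^\Gamma K^T$ that contains $\Pr^\Gamma\Omega$ contains the set $\{\mu\in\Pr^\Gamma K^T:\ \rho(\mu,\nu)<\varepsilon\text{ for some }\nu\in\Pr^\Gamma\Omega\}$ for some $\varepsilon>0$; and for every $\varepsilon>0$ this set contains a vaguely open subset of $\Pr^\Gamma K^T$ that contains $\Pr^\Gamma\Omega$. Then $\Pr^\Gamma\Omega$ is also a Poulsen simplex. -/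

import Mathlib

open MeasureTheory Set
open scoped ENNReal

universe u w

noncomputable section

/-! ### Convexity: Choquet simplices and Poulsen simplices -/

/-- The cone `{(t x, t) : t ≥ 0, x ∈ S}` over a convex set `S`. -/
def coneOver {E : Type*} [AddCommGroup E] [Module ℝ E] (S : Set E) : Set (E × ℝ) :=
  {p | ∃ t : ℝ, 0 ≤ t ∧ ∃ x ∈ S, p = (t • x, t)}

/-- A compact convex set is a (Choquet) simplex if the cone over it is a lattice in its own order,
in which `a ≤ b` means that `b - a` lies in the cone. -/
structure IsChoquetSimplex {E : Type*} [AddCommGroup E] [Module ℝ E] [TopologicalSpace E]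
    (S : Set E) : Prop where
  isCompact : IsCompact S
  convex : Convex ℝ S
  exists_inf : ∀ p ∈ coneOver S, ∀ q ∈ coneOver S, ∃ r ∈ coneOver S,
    p - r ∈ coneOver S ∧ q - r ∈ coneOver S ∧
      ∀ s ∈ coneOver S, p - s ∈ coneOver S → q - s ∈ coneOver S → r - s ∈ coneOver S
  exists_sup : ∀ p ∈ coneOver S, ∀ q ∈ coneOver S, ∃ r ∈ coneOver S,
    r - p ∈ coneOver S ∧ r - q ∈ coneOver S ∧
      ∀ s ∈ coneOver S, s - p ∈ coneOver S → s - q ∈ coneOver S → s - r ∈ coneOver S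

/-- A Poulsen simplex: a metrizable simplex with more than one point,
whose extreme points are dense in it. -/
structure IsPoulsenSimplex {E : Type*} [AddCommGroup E] [Module ℝ E] [TopologicalSpace E]
    (S : Set E) : Prop where
  nontrivial : S.Nontrivial
  metrizable : TopologicalSpace.MetrizableSpace S
  simplex : IsChoquetSimplex S
  dense_extremePoints : S ⊆ closure (S.extremePoints ℝ)

/-! ### Probability measures as functionals -/

/-- A probability measure `μ` on a compact space, as the functional `f ↦ ∫ f dμ` in the dual of the
space of continuous functions; this dual carries the weak-star (vague) topology. -/
def toFunctional {X : Type*} [TopologicalSpace X] [CompactSpace X] [MeasurableSpace X]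
    [OpensMeasurableSpace X] (μ : ProbabilityMeasure X) : WeakDual ℝ C(X, ℝ) :=
  StrongDual.toWeakDual <| LinearMap.mkContinuous
    { toFun := fun f => ∫ x, f x ∂(μ : Measure X)
      map_add' := fun f g => integral_add
        (BoundedContinuousFunction.integrable _ (BoundedContinuousFunction.mkOfCompact f))
        (BoundedContinuousFunction.integrable _ (BoundedContinuousFunction.mkOfCompact g))
      map_smul' := fun c f => integral_const_mul c f } 1
    (fun f => by
      have h := norm_integral_le_of_norm_le_const (μ := (μ : Measure X)) (f := fun x => f x)
        (Filter.Eventually.of_forall fun x => f.norm_coe_le_norm x)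
      simpa using h)

theorem toFunctional_apply {X : Type*} [TopologicalSpace X] [CompactSpace X] [MeasurableSpace X]
    [OpensMeasurableSpace X] (μ : ProbabilityMeasure X) (f : C(X, ℝ)) :
    toFunctional μ f = ∫ x, f x ∂(μ : Measure X) := rfl

/-! ### Exchangeable measures -/

instance compactMetric_secondCountable {K : Type*} [MetricSpace K] [CompactSpace K] :
    SecondCountableTopology K :=
  EMetric.secondCountable_of_sigmaCompact K

/-- The coordinate-permuting action: `(shift γ ω)_t = ω_{γ(t)}`. -/
def shift {T K : Type*} (γ : Equiv.Perm T) (ω : T → K) : T → K := fun t => ω (γ t)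

/-- The exchangeable probability measures: those on `K^T` that are invariant under `Γ`. -/
def exchMeasures {T : Type*} (Γ : Subgroup (Equiv.Perm T)) (K : Type*) [MeasurableSpace K] :
    Set (ProbabilityMeasure (T → K)) :=
  {μ | ∀ γ ∈ Γ, (μ : Measure (T → K)).map (shift γ) = (μ : Measure (T → K))}

/-- The exchangeable probability measures that are concentrated on `Ω ⊆ K^T`. -/
def exchMeasuresOn {T : Type*} (Γ : Subgroup (Equiv.Perm T)) {K : Type*} [MeasurableSpace K]
    (Ω : Set (T → K)) : Set (ProbabilityMeasure (T → K)) :=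
  {μ | μ ∈ exchMeasures Γ K ∧ (μ : Measure (T → K)) Ω = 1}

/-- The context `Γ ↷ T` has the Poulsen property if, for every compact metric space `K` with at
least two points, the exchangeable measures on `K^T` form a Poulsen simplex. -/
def HasPoulsenProperty {T : Type w} [Countable T] (Γ : Subgroup (Equiv.Perm T)) : Prop :=
  ∀ (K : Type u) [MetricSpace K] [CompactSpace K] [Nontrivial K] [MeasurableSpace K]
    [BorelSpace K], IsPoulsenSimplex (toFunctional '' exchMeasures Γ K)

/-! ### Joinings and the d-bar metric -/

/-- The joinings of `μ` and `ν`: probability measures on `K^T × K^T` that are invariant under the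
diagonal action of `Γ` and have marginals `μ` and `ν`. -/
def joinings {T : Type*} (Γ : Subgroup (Equiv.Perm T)) {K : Type*} [MeasurableSpace K]
    (μ ν : ProbabilityMeasure (T → K)) : Set (ProbabilityMeasure ((T → K) × (T → K))) :=
  {l | (∀ γ ∈ Γ, (l : Measure ((T → K) × (T → K))).map (Prod.map (shift γ) (shift γ)) =
          (l : Measure ((T → K) × (T → K)))) ∧
       (l : Measure ((T → K) × (T → K))).map Prod.fst = (μ : Measure (T → K)) ∧
       (l : Measure ((T → K) × (T → K))).map Prod.snd = (ν : Measure (T → K))}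

/-- The d-bar distance, with reference index `v`. -/
def dbar {T : Type*} (Γ : Subgroup (Equiv.Perm T)) {K : Type*} [MeasurableSpace K] (v : T)
    (μ ν : ProbabilityMeasure (T → K)) : ℝ≥0∞ :=
  ⨅ l ∈ joinings Γ μ ν, (l : Measure ((T → K) × (T → K))) {p | p.1 v ≠ p.2 v}

/-- The `ε`-neighbourhood of a set `S` of exchangeable measures for the d-bar distance. -/
def dbarNhd {T : Type*} (Γ : Subgroup (Equiv.Perm T)) {K : Type*} [MeasurableSpace K] (v : T)
    (S : Set (ProbabilityMeasure (T → K))) (ε : ℝ≥0∞) : Set (ProbabilityMeasure (T → K)) :=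
  {μ | μ ∈ exchMeasures Γ K ∧ ∃ ν ∈ S, dbar Γ v μ ν < ε}

/-- Around the set `S`, and inside the space of all exchangeable measures, the vague neighbourhoods
and the d-bar neighbourhoods form equivalent neighbourhood bases. The topology on
`ProbabilityMeasure` is that of weak convergence, which is the vague topology as `K^T` is
compact. -/
def NhdBasesEquivalent {T : Type*} [Countable T] (Γ : Subgroup (Equiv.Perm T)) {K : Type*}
    [MetricSpace K] [CompactSpace K] [MeasurableSpace K] [BorelSpace K] (v : T)
    (S : Set (ProbabilityMeasure (T → K))) : Prop :=
  (∀ U : Set (ProbabilityMeasure (T → K)), IsOpen U → S ⊆ U →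
    ∃ ε : ℝ≥0∞, 0 < ε ∧ dbarNhd Γ v S ε ⊆ U) ∧
  (∀ ε : ℝ≥0∞, 0 < ε →
    ∃ U : Set (ProbabilityMeasure (T → K)), IsOpen U ∧ S ⊆ U ∧
      U ∩ exchMeasures Γ K ⊆ dbarNhd Γ v S ε)

end

/-! Having mass $1$ on the closed set $\Omega$ cuts a closed face out of the simplex $\Pr^\Gamma
K^T$, and a closed face of a simplex is a simplex (`IsChoquetSimplex.of_isExtreme`). Only the
density of the extreme points needs dynamics.

A measure $\mu$ on $\Omega$ is a vague limit of extreme points $m$ of $\Pr^\Gamma K^T$, and these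
are eventually d-bar close to $\Pr^\Gamma\Omega$. The joinings of such an $m$ with measures on
$\Omega$ form a closed face of $\Pr^\Gamma (K\times K)^T$, because $m$ is extreme; minimising the
mismatch at $v$ over this face gives an extreme joining (`exists_extreme_joining`). Factors of
extreme measures are extreme (`map_mem_extremeMeasures`).

The second marginal is an extreme measure on $\Omega$, but it is known to be near $m$ only along the
orbit of $v$. So the factor used takes second entries on that orbit and first entries elsewhere. It
is near $m$ at every coordinate and at d-bar distance $0$ from a measure on $\Omega$, which by the
first half of the hypothesis on neighbourhoods puts it in $\Pr^\Gamma\Omega$. -/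

open Topology
open scoped NNReal

/-! ### Closed faces of simplices -/

section Faces

variable {E : Type*} [AddCommGroup E] [Module ℝ E] {S F : Set E}

theorem coneOver_mono (h : F ⊆ S) : coneOver F ⊆ coneOver S := by
  rintro p ⟨t, ht, x, hx, rfl⟩
  exact ⟨t, ht, x, h hx, rfl⟩

theorem add_mem_coneOver (hS : Convex ℝ S) {p q : E × ℝ} (hp : p ∈ coneOver S)
    (hq : q ∈ coneOver S) : p + q ∈ coneOver S := by
  obtain ⟨s, hs, x, hx, rfl⟩ := hp
  obtain ⟨t, ht, y, hy, rfl⟩ := hq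
  rcases (add_nonneg hs ht).eq_or_lt with h | h
  · have hs0 : s = 0 := by linarith
    have ht0 : t = 0 := by linarith
    exact ⟨0, le_rfl, x, hx, by simp [hs0, ht0]⟩
  · refine ⟨s + t, h.le, (s / (s + t)) • x + (t / (s + t)) • y,
      hS hx hy (by positivity) (by positivity) (by field_simp), ?_⟩
    have h1 : (s + t) * (s / (s + t)) = s := by field_simp
    have h2 : (s + t) * (t / (s + t)) = t := by field_simp
    simp only [Prod.mk_add_mk, smul_add, smul_smul, h1, h2]

/-- After division by the total mass, the base point of the sum is a proper convex combination of
the two base points, unless a mass vanishes. So the cone over a face is downward closed in the order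
of the larger cone. -/
theorem IsExtreme.mem_coneOver_of_add_mem (hF : IsExtreme ℝ S F) {p q : E × ℝ}
    (hp : p ∈ coneOver S) (hq : q ∈ coneOver S) (h : p + q ∈ coneOver F) : p ∈ coneOver F := by
  obtain ⟨s, hs, x, hx, rfl⟩ := hp
  obtain ⟨t, ht, y, hy, rfl⟩ := hq
  obtain ⟨r, hr, z, hz, h⟩ := h
  simp only [Prod.mk_add_mk, Prod.mk.injEq] at h
  obtain ⟨h, rfl⟩ := h
  rcases hs.eq_or_lt with rfl | hs
  · exact ⟨0, le_rfl, z, hz, by simp⟩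
  rcases ht.eq_or_lt with rfl | ht
  · exact ⟨s, hs.le, z, hz, by simpa using h⟩
  refine ⟨s, hs.le, x, hF.left_mem_of_mem_openSegment hx hy hz ?_, rfl⟩
  refine ⟨s / (s + t), t / (s + t), by positivity, by positivity, by field_simp, ?_⟩
  have hst : s + t ≠ 0 := by positivity
  apply smul_right_injective E hst
  have h1 : (s + t) * (s / (s + t)) = s := by field_simp
  have h2 : (s + t) * (t / (s + t)) = t := by field_simp
  simp only [smul_add, smul_smul, h1, h2, h]

theorem IsChoquetSimplex.of_isExtreme [TopologicalSpace E] (hS : IsChoquetSimplex S)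
    (hF : IsExtreme ℝ S F) (hFc : IsCompact F) (hFconv : Convex ℝ F) : IsChoquetSimplex F where
  isCompact := hFc
  convex := hFconv
  exists_inf p hp q hq := by
    have hmono := coneOver_mono hF.subset
    obtain ⟨r, hr, hpr, hqr, hmax⟩ := hS.exists_inf p (hmono hp) q (hmono hq)
    have hrF : r ∈ coneOver F := hF.mem_coneOver_of_add_mem hr hpr (by simpa using hp)
    refine ⟨r, hrF, hF.mem_coneOver_of_add_mem hpr hr (by simpa using hp),
      hF.mem_coneOver_of_add_mem hqr hr (by simpa using hq), fun s hs hps hqs => ?_⟩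
    exact hF.mem_coneOver_of_add_mem (hmax s (hmono hs) (hmono hps) (hmono hqs)) (hmono hs)
      (by simpa using hrF)
  exists_sup p hp q hq := by
    have hmono := coneOver_mono hF.subset
    obtain ⟨r, hr, hpr, hqr, hmin⟩ := hS.exists_sup p (hmono hp) q (hmono hq)
    have hpq : p + q ∈ coneOver F := add_mem_coneOver hFconv hp hq
    -- The sum is an upper bound of `p` and `q` in the cone over `F`, so the supremum lies below it
    -- and heredity applies.
    have hle : p + q - r ∈ coneOver S :=
      hmin _ (hmono hpq) (by simpa using hmono hq) (by simpa using hmono hp)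
    have hrF : r ∈ coneOver F := hF.mem_coneOver_of_add_mem hr hle (by simpa using hpq)
    refine ⟨r, hrF, hF.mem_coneOver_of_add_mem hpr (hmono hp) (by simpa using hrF),
      hF.mem_coneOver_of_add_mem hqr (hmono hq) (by simpa using hrF), fun s hs hps hqs => ?_⟩
    exact hF.mem_coneOver_of_add_mem (hmin s (hmono hs) (hmono hps) (hmono hqs)) hr
      (by simpa using hs)

end Faces

/-! ### Mixtures of probability measures -/

/-- `IsMixture a b m₁ m₂ μ` says that `μ = a m₁ + b m₂` is a proper convex combination. -/
structure IsMixture {X : Type*} [MeasurableSpace X] (a b : ℝ≥0)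
    (m₁ m₂ μ : ProbabilityMeasure X) : Prop where
  left_pos : 0 < a
  right_pos : 0 < b
  add_eq_one : a + b = 1
  eq_add : (μ : Measure X) = a • (m₁ : Measure X) + b • (m₂ : Measure X)

/-- A set of measures `L ⊆ S` is a face of `S` if a mixture of members of `S` lies in `L` only if
its components do. -/
structure IsMixtureFace {X : Type*} [MeasurableSpace X] (S L : Set (ProbabilityMeasure X)) :
    Prop where
  subset : L ⊆ S
  mem_of_isMixture : ∀ m₁ ∈ S, ∀ m₂ ∈ S, ∀ μ ∈ L, ∀ a b : ℝ≥0, IsMixture a b m₁ m₂ μ → m₁ ∈ L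

/-- The members of `S` that are not proper mixtures of other members of `S`. -/
def extremeMeasures {X : Type*} [MeasurableSpace X] (S : Set (ProbabilityMeasure X)) :
    Set (ProbabilityMeasure X) :=
  {μ | μ ∈ S ∧ ∀ m₁ ∈ S, ∀ m₂ ∈ S, ∀ a b : ℝ≥0, IsMixture a b m₁ m₂ μ → m₁ = μ}

section Mixtures

variable {X Y : Type*} [MeasurableSpace X] [MeasurableSpace Y] {a b : ℝ≥0}
  {m₁ m₂ μ : ProbabilityMeasure X} {S L : Set (ProbabilityMeasure X)}

theorem IsMixture.symm (h : IsMixture a b m₁ m₂ μ) : IsMixture b a m₂ m₁ μ :=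
  ⟨h.right_pos, h.left_pos, by rw [add_comm, h.add_eq_one], by rw [h.eq_add, add_comm]⟩

theorem IsMixture.map (h : IsMixture a b m₁ m₂ μ) {f : X → Y} (hf : Measurable f) :
    IsMixture a b (m₁.map hf.aemeasurable) (m₂.map hf.aemeasurable) (μ.map hf.aemeasurable) where
  left_pos := h.left_pos
  right_pos := h.right_pos
  add_eq_one := h.add_eq_one
  eq_add := by
    simp only [ProbabilityMeasure.toMeasure_map, h.eq_add]
    rw [Measure.map_add _ _ hf, Measure.map_smul, Measure.map_smul]

/-- An average reaches $c$ with one term at most $c$ only if the other is at least $c$. With $c$ the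
maximal mass of a set, this makes the maximisers a face. -/
theorem IsMixture.le_left_apply (h : IsMixture a b m₁ m₂ μ) {c : ℝ≥0∞} {s : Set X}
    (hμ : c ≤ (μ : Measure X) s) (h₂ : (m₂ : Measure X) s ≤ c) : c ≤ (m₁ : Measure X) s := by
  have hc : c ≠ ∞ := ne_top_of_le_ne_top (measure_ne_top _ _) hμ
  have h1 : (m₁ : Measure X) s ≠ ∞ := measure_ne_top _ _
  have h2 : (m₂ : Measure X) s ≠ ∞ := measure_ne_top _ _
  rw [h.eq_add, Measure.add_apply, Measure.smul_apply, Measure.smul_apply] at hμ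
  generalize (m₁ : Measure X) s = x at *
  generalize (m₂ : Measure X) s = y at *
  lift c to ℝ≥0 using hc
  lift x to ℝ≥0 using h1
  lift y to ℝ≥0 using h2
  simp only [ENNReal.smul_def, smul_eq_mul] at hμ
  norm_cast at *
  have ha := h.left_pos
  have hab : (a : ℝ) + b = 1 := by exact_mod_cast h.add_eq_one
  have hb := h.right_pos
  rw [← NNReal.coe_le_coe] at *
  rw [← NNReal.coe_lt_coe] at *
  push_cast at *
  by_contra! hlt
  nlinarith

theorem IsMixtureFace.extremeMeasures_subset (h : IsMixtureFace S L) :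
    extremeMeasures L ⊆ extremeMeasures S := by
  rintro μ ⟨hμ, hext⟩
  refine ⟨h.subset hμ, fun m₁ h₁ m₂ h₂ a b hm => ?_⟩
  exact hext m₁ (h.mem_of_isMixture m₁ h₁ m₂ h₂ μ hμ a b hm) m₂
    (h.mem_of_isMixture m₂ h₂ m₁ h₁ μ hμ b a hm.symm) a b hm

theorem extremeMeasures_inter_subset (h : L ⊆ S) :
    extremeMeasures S ∩ L ⊆ extremeMeasures L :=
  fun _ hμ => ⟨hμ.2, fun m₁ h₁ m₂ h₂ => hμ.1.2 m₁ (h h₁) m₂ (h h₂)⟩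

end Mixtures

/-! ### Measures as functionals -/

section Functionals

variable {X : Type*} [TopologicalSpace X] [CompactSpace X] [MeasurableSpace X]

/-- Needed for the Krein–Milman theorem in `extremeMeasures_nonempty`. -/
instance WeakDual.locallyConvexSpace_real {E : Type*} [AddCommGroup E] [Module ℝ E]
    [TopologicalSpace E] :
    LocallyConvexSpace ℝ (WeakDual ℝ E) :=
  inferInstanceAs (LocallyConvexSpace ℝ (WeakBilin (topDualPairing ℝ E)))

/-- Both topologies are those of convergence of integrals of continuous functions; compactness and
closures can thus be moved between measures and functionals. -/
theorem isInducing_toFunctional [OpensMeasurableSpace X] :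
    IsInducing (toFunctional : ProbabilityMeasure X → WeakDual ℝ C(X, ℝ)) := by
  rw [isInducing_iff_nhds]
  refine fun μ => le_antisymm ?_ ?_
  · have hcont : Continuous (toFunctional : ProbabilityMeasure X → WeakDual ℝ C(X, ℝ)) := by
      refine WeakDual.continuous_of_continuous_eval fun f => ?_
      rw [continuous_iff_continuousAt]
      intro ν
      exact ProbabilityMeasure.tendsto_iff_forall_integral_tendsto.1 Filter.tendsto_id
        (BoundedContinuousFunction.mkOfCompact f)
    exact (hcont.tendsto μ).le_comap
  · refine Filter.tendsto_id'.1
      (ProbabilityMeasure.tendsto_iff_forall_integral_tendsto.2 fun f => ?_)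
    exact ((WeakDual.eval_continuous f.toContinuousMap).tendsto (toFunctional μ)).comp
      Filter.tendsto_comap

variable {a b : ℝ≥0} {m₁ m₂ μ : ProbabilityMeasure X}
  {S L : Set (ProbabilityMeasure X)}

theorem integral_mixture [OpensMeasurableSpace X] (f : C(X, ℝ)) :
    ∫ x, f x ∂(a • (m₁ : Measure X) + b • (m₂ : Measure X)) =
      a * ∫ x, f x ∂(m₁ : Measure X) + b * ∫ x, f x ∂(m₂ : Measure X) := by
  have hi : ∀ m : ProbabilityMeasure X, Integrable f (m : Measure X) := fun m =>
    BoundedContinuousFunction.integrable _ (BoundedContinuousFunction.mkOfCompact f)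
  rw [integral_add_measure ((hi m₁).smul_measure_nnreal) ((hi m₂).smul_measure_nnreal),
    integral_smul_nnreal_measure, integral_smul_nnreal_measure]
  rfl

variable [BorelSpace X] [HasOuterApproxClosed X]

theorem toFunctional_injective :
    Function.Injective (toFunctional : ProbabilityMeasure X → WeakDual ℝ C(X, ℝ)) := by
  intro μ ν h
  refine Subtype.ext (ext_of_forall_integral_eq_of_IsFiniteMeasure
    (μ := (μ : Measure X)) (ν := (ν : Measure X)) fun f => ?_)
  exact DFunLike.congr_fun h f.toContinuousMap

theorem eq_mixture_iff_toFunctional :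
    (μ : Measure X) = a • (m₁ : Measure X) + b • (m₂ : Measure X) ↔
      (a : ℝ) • toFunctional m₁ + (b : ℝ) • toFunctional m₂ = toFunctional μ := by
  constructor
  · intro h
    refine DFunLike.ext _ _ fun f => ?_
    change a * ∫ x, f x ∂(m₁ : Measure X) + b * ∫ x, f x ∂(m₂ : Measure X) = _
    rw [toFunctional_apply, h, integral_mixture]
  · intro h
    refine ext_of_forall_integral_eq_of_IsFiniteMeasure fun f => ?_
    have := DFunLike.congr_fun h f.toContinuousMap
    exact (this.symm.trans (integral_mixture f.toContinuousMap).symm)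

theorem mem_openSegment_toFunctional_iff :
    toFunctional μ ∈ openSegment ℝ (toFunctional m₁) (toFunctional m₂) ↔
      ∃ a b : ℝ≥0, IsMixture a b m₁ m₂ μ := by
  constructor
  · rintro ⟨a, b, ha, hb, hab, h⟩
    lift a to ℝ≥0 using ha.le
    lift b to ℝ≥0 using hb.le
    exact ⟨a, b, by exact_mod_cast ha, by exact_mod_cast hb, by exact_mod_cast hab,
      eq_mixture_iff_toFunctional.2 h⟩
  · rintro ⟨a, b, h⟩
    exact ⟨a, b, h.left_pos, h.right_pos, by exact_mod_cast h.add_eq_one,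
      eq_mixture_iff_toFunctional.1 h.eq_add⟩

theorem extremePoints_toFunctional_image :
    (toFunctional '' S).extremePoints ℝ = toFunctional '' extremeMeasures S := by
  ext x
  constructor
  · rintro ⟨⟨μ, hμ, rfl⟩, h⟩
    refine ⟨μ, ⟨hμ, fun m₁ h₁ m₂ h₂ a b hm => toFunctional_injective ?_⟩, rfl⟩
    exact h (mem_image_of_mem _ h₁) (mem_image_of_mem _ h₂)
      (mem_openSegment_toFunctional_iff.2 ⟨a, b, hm⟩)
  · rintro ⟨μ, ⟨hμ, h⟩, rfl⟩
    refine ⟨mem_image_of_mem _ hμ, ?_⟩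
    rintro _ ⟨m₁, h₁, rfl⟩ _ ⟨m₂, h₂, rfl⟩ hm
    obtain ⟨a, b, hm⟩ := mem_openSegment_toFunctional_iff.1 hm
    rw [h m₁ h₁ m₂ h₂ a b hm]

theorem IsMixtureFace.isExtreme (h : IsMixtureFace S L) :
    IsExtreme ℝ (toFunctional '' S) (toFunctional '' L) := by
  refine ⟨image_mono h.subset, ?_⟩
  rintro _ ⟨m₁, h₁, rfl⟩ _ ⟨m₂, h₂, rfl⟩ _ ⟨μ, hμ, rfl⟩ hm
  obtain ⟨a, b, hm⟩ := mem_openSegment_toFunctional_iff.1 hm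
  exact mem_image_of_mem _ (h.mem_of_isMixture m₁ h₁ m₂ h₂ μ hμ a b hm)

theorem extremeMeasures_nonempty (hS : IsCompact S) (hne : S.Nonempty) :
    (extremeMeasures S).Nonempty := by
  have := (isInducing_toFunctional.isCompact_iff.1 hS).extremePoints_nonempty (hne.image _)
  rw [extremePoints_toFunctional_image] at this
  exact this.of_image

omit [CompactSpace X] in
theorem upperSemicontinuous_measure_apply {F : Set X} (hF : IsClosed F) :
    UpperSemicontinuous fun μ : ProbabilityMeasure X => (μ : Measure X) F := by
  intro μ c hc
  exact Filter.eventually_lt_of_limsup_lt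
    ((ProbabilityMeasure.limsup_measure_closed_le_of_tendsto Filter.tendsto_id hF).trans_lt hc)

omit [CompactSpace X] in
theorem isClosed_setOf_le_measure {F : Set X} (hF : IsClosed F) (c : ℝ≥0∞) :
    IsClosed {μ : ProbabilityMeasure X | c ≤ (μ : Measure X) F} :=
  upperSemicontinuous_iff_isClosed_preimage.1 (upperSemicontinuous_measure_apply hF) c

/-- A closed set attains its maximal measure over a compact face at an extreme measure. -/
theorem exists_extremeMeasure_forall_apply_le (hface : IsMixtureFace S L) (hL : IsCompact L)
    (hne : L.Nonempty) {F : Set X} (hF : IsClosed F) :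
    ∃ μ ∈ extremeMeasures S ∩ L, ∀ ν ∈ L, (ν : Measure X) F ≤ (μ : Measure X) F := by
  obtain ⟨m, hmL, hmax⟩ :=
    (upperSemicontinuous_measure_apply hF).upperSemicontinuousOn L |>.exists_isMaxOn hne hL
  -- The maximisers form a compact face of `S`, so an extreme point of `M` is extreme in `S`.
  set M : Set (ProbabilityMeasure X) := L ∩ {μ | (m : Measure X) F ≤ (μ : Measure X) F}
  have hMc : IsCompact M := hL.inter_right (isClosed_setOf_le_measure hF _)
  have hMface : IsMixtureFace S M := by
    refine ⟨fun μ hμ => hface.subset hμ.1, fun m₁ h₁ m₂ h₂ μ hμ a b hm => ?_⟩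
    have h₁' := hface.mem_of_isMixture m₁ h₁ m₂ h₂ μ hμ.1 a b hm
    have h₂' := hface.mem_of_isMixture m₂ h₂ m₁ h₁ μ hμ.1 b a hm.symm
    exact ⟨h₁', hm.le_left_apply hμ.2 (hmax h₂')⟩
  obtain ⟨μ, hμ⟩ := extremeMeasures_nonempty hMc ⟨m, hmL, le_refl ((m : Measure X) F)⟩
  exact ⟨μ, ⟨hMface.extremeMeasures_subset hμ, hμ.1.1⟩, fun ν hν => (hmax hν).trans hμ.1.2⟩

end Functionals

/-! ### Factors of extreme invariant measures -/

section Factors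

variable {X Y : Type*} [MeasurableSpace X] [MeasurableSpace Y]

theorem map_withDensity_comp (μ : Measure X) {φ : X → Y} (hφ : Measurable φ) {h : Y → ℝ≥0∞}
    (hh : Measurable h) :
    (μ.withDensity (h ∘ φ)).map φ = (μ.map φ).withDensity h := by
  ext s hs
  rw [Measure.map_apply hφ hs, withDensity_apply _ (hφ hs), withDensity_apply _ hs,
    setLIntegral_map hs hh hφ]
  rfl

/-- Pushing the measure with density `h ∘ g` forward by `g` gives the one with density `h`; undoing
this by the inverse shows the two measures equal. Densities of finite measures are unique almost
everywhere. -/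
theorem comp_ae_eq_of_map_withDensity_eq {ν : Measure X} {g g' : X → X}
    (hg : Measurable g) (hg' : Measurable g') (hinv : g' ∘ g = id) (hν : ν.map g = ν)
    {h : X → ℝ≥0∞} (hh : Measurable h) (hfin : ∫⁻ x, h x ∂ν ≠ ∞)
    (hm : (ν.withDensity h).map g' = ν.withDensity h) : h ∘ g =ᵐ[ν] h := by
  have key : (ν.withDensity (h ∘ g)).map g = ν.withDensity h := by
    rw [map_withDensity_comp ν hg hh, hν]
  have : ν.withDensity (h ∘ g) = ν.withDensity h := by
    rw [← key, Measure.map_map hg' hg, hinv, Measure.map_id] at hm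
    exact hm.trans key
  refine (withDensity_eq_iff (hh.comp hg).aemeasurable hh.aemeasurable ?_).1 this
  have h1 : ∫⁻ x, h (g x) ∂ν = ∫⁻ x, h x ∂ν := by rw [← lintegral_map hh hg, hν]
  simpa [h1] using hfin

theorem shift_comp_shift {T K : Type*} (γ δ : Equiv.Perm T) :
    (shift γ ∘ shift δ : (T → K) → T → K) = shift (δ * γ) := rfl

theorem measurable_shift {T K : Type*} [MeasurableSpace K] (γ : Equiv.Perm T) :
    Measurable (shift γ : (T → K) → T → K) :=
  measurable_pi_lambda _ fun t => measurable_pi_apply (γ t)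

variable {T : Type*} {Γ : Subgroup (Equiv.Perm T)} {A B : Type*} [MeasurableSpace A]
  [MeasurableSpace B]

theorem map_mem_exchMeasures {μ : ProbabilityMeasure (T → A)} (hμ : μ ∈ exchMeasures Γ A)
    {φ : (T → A) → T → B} (hφ : Measurable φ)
    (hequiv : ∀ γ ∈ Γ, φ ∘ shift γ = shift γ ∘ φ) :
    μ.map hφ.aemeasurable ∈ exchMeasures Γ B := by
  intro γ hγ
  rw [ProbabilityMeasure.toMeasure_map, Measure.map_map (measurable_shift γ) hφ, ← hequiv γ hγ,
    ← Measure.map_map hφ (measurable_shift γ), hμ γ hγ]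

/-- An invariant measure that is absolutely continuous with respect to a factor of an invariant
measure lifts to an absolutely continuous invariant measure. -/
theorem exists_lift_withDensity {μ : ProbabilityMeasure (T → A)} (hμ : μ ∈ exchMeasures Γ A)
    {φ : (T → A) → T → B} (hφ : Measurable φ)
    (hequiv : ∀ γ ∈ Γ, φ ∘ shift γ = shift γ ∘ φ) {m : ProbabilityMeasure (T → B)}
    (hm : m ∈ exchMeasures Γ B) {h : (T → B) → ℝ≥0∞} (hh : Measurable h)
    (hd : (m : Measure (T → B)) = ((μ : Measure (T → A)).map φ).withDensity h) :
    ∃ m' ∈ exchMeasures Γ A, (m' : Measure (T → A)) = (μ : Measure (T → A)).withDensity (h ∘ φ) ∧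
      (m' : Measure (T → A)).map φ = m := by
  have hmap := (map_withDensity_comp (μ : Measure (T → A)) hφ hh).trans hd.symm
  have hprob : IsProbabilityMeasure ((μ : Measure (T → A)).withDensity (h ∘ φ)) := by
    constructor
    have := congrArg (fun ν => ν univ) hmap
    simpa [Measure.map_apply hφ MeasurableSet.univ] using this
  refine ⟨⟨_, hprob⟩, fun γ hγ => ?_, rfl, hmap⟩
  have hγφ : (φ ∘ shift γ : (T → A) → T → B) = shift γ ∘ φ := hequiv γ hγ
  have hfin : ∫⁻ x, h x ∂((μ : Measure (T → A)).map φ) ≠ ∞ := by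
    have := congrArg (fun ν => ν univ) hd
    simp only [measure_univ, withDensity_apply _ MeasurableSet.univ, Measure.restrict_univ] at this
    rw [← this]
    exact ENNReal.one_ne_top
  have hae : h ∘ shift γ =ᵐ[(μ : Measure (T → A)).map φ] h := by
    refine comp_ae_eq_of_map_withDensity_eq (measurable_shift γ) (measurable_shift γ⁻¹) ?_
      ?_ hh hfin ?_
    · rw [shift_comp_shift, mul_inv_cancel]
      rfl
    · exact map_mem_exchMeasures hμ hφ hequiv γ hγ
    · rw [← hd]
      exact hm γ⁻¹ (inv_mem hγ)
  have hae' : (h ∘ φ) ∘ shift γ =ᵐ[(μ : Measure (T → A))] h ∘ φ := by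
    have := ae_of_ae_map hφ.aemeasurable hae
    filter_upwards [this] with x hx
    have hx' := congrFun hγφ x
    simp only [Function.comp_apply] at hx hx' ⊢
    rw [hx', hx]
  change ((μ : Measure (T → A)).withDensity (h ∘ φ)).map (shift γ) =
    (μ : Measure (T → A)).withDensity (h ∘ φ)
  conv_lhs => rw [← withDensity_congr_ae hae', map_withDensity_comp _ (measurable_shift γ)
    (hh.comp hφ), hμ γ hγ]

/-- A factor of an extreme invariant measure is extreme. -/
theorem map_mem_extremeMeasures {μ : ProbabilityMeasure (T → A)}
    (hμ : μ ∈ extremeMeasures (exchMeasures Γ A)) {φ : (T → A) → T → B} (hφ : Measurable φ)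
    (hequiv : ∀ γ ∈ Γ, φ ∘ shift γ = shift γ ∘ φ) :
    μ.map hφ.aemeasurable ∈ extremeMeasures (exchMeasures Γ B) := by
  refine ⟨map_mem_exchMeasures hμ.1 hφ hequiv, fun m₁ h₁ m₂ h₂ a b hmix => ?_⟩
  set ν : Measure (T → B) := (μ : Measure (T → A)).map φ
  have hνp : IsProbabilityMeasure ν := Measure.isProbabilityMeasure_map hφ.aemeasurable
  have heq : ν = a • (m₁ : Measure (T → B)) + b • (m₂ : Measure (T → B)) := hmix.eq_add
  -- A component with positive weight is absolutely continuous with respect to the mixture, so it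
  -- has a Radon–Nikodym density.
  have hac : ∀ {m : ProbabilityMeasure (T → B)} {m' : ProbabilityMeasure (T → B)} {a b : ℝ≥0},
      0 < a → ν = a • (m : Measure (T → B)) + b • (m' : Measure (T → B)) →
      (m : Measure (T → B)) = ν.withDensity ((m : Measure (T → B)).rnDeriv ν) := by
    intro m m' a b ha h
    refine (Measure.withDensity_rnDeriv_eq _ _ ?_).symm
    intro s hs
    rw [h, Measure.add_apply, Measure.smul_apply, ENNReal.smul_def, smul_eq_mul,
      add_eq_zero, mul_eq_zero] at hs
    exact hs.1.resolve_left (by simpa using ha.ne')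
  have hd₁ := hac hmix.left_pos heq
  have hd₂ := hac hmix.right_pos (heq.trans (add_comm _ _))
  set f := (m₁ : Measure (T → B)).rnDeriv ν
  set g := (m₂ : Measure (T → B)).rnDeriv ν
  have hf : Measurable f := Measure.measurable_rnDeriv _ _
  have hg : Measurable g := Measure.measurable_rnDeriv _ _
  obtain ⟨l₁, hl₁, hl₁d, hl₁m⟩ := exists_lift_withDensity hμ.1 hφ hequiv h₁ hf hd₁
  obtain ⟨l₂, hl₂, hl₂d, -⟩ := exists_lift_withDensity hμ.1 hφ hequiv h₂ hg hd₂
  -- The weighted densities sum to $1$, so their lifts mix to `μ`; extremality of `μ` then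
  -- identifies the first lift with `μ`.
  have hone : (fun y => (a : ℝ≥0∞) * f y + b * g y) =ᵐ[ν] fun _ => 1 := by
    refine (withDensity_eq_iff (by fun_prop) (by fun_prop) ?_).1 ?_
    · rw [lintegral_add_left (by fun_prop), lintegral_const_mul _ hf, lintegral_const_mul _ hg]
      have hfint : ∫⁻ y, f y ∂ν ≠ ∞ := Measure.lintegral_rnDeriv_lt_top _ _ |>.ne
      have hgint : ∫⁻ y, g y ∂ν ≠ ∞ := Measure.lintegral_rnDeriv_lt_top _ _ |>.ne
      finiteness
    · have : (fun y => (a : ℝ≥0∞) * f y + b * g y) = (a : ℝ≥0∞) • f + (b : ℝ≥0∞) • g := rfl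
      rw [this, withDensity_add_left (hf.const_smul _), withDensity_smul _ hf,
        withDensity_smul _ hg, ← hd₁, ← hd₂, withDensity_const, one_smul]
      exact heq.symm
  have hl : l₁ = μ := by
    refine hμ.2 l₁ hl₁ l₂ hl₂ a b ⟨hmix.left_pos, hmix.right_pos, hmix.add_eq_one, ?_⟩
    have hone' : (a : ℝ≥0∞) • (f ∘ φ) + (b : ℝ≥0∞) • (g ∘ φ) =ᵐ[(μ : Measure (T → A))]
        fun _ => 1 := ae_of_ae_map hφ.aemeasurable hone
    have : (μ : Measure (T → A)).withDensity
        ((a : ℝ≥0∞) • (f ∘ φ) + (b : ℝ≥0∞) • (g ∘ φ)) = μ := by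
      rw [withDensity_congr_ae hone', withDensity_const, one_smul]
    rw [withDensity_add_left ((hf.comp hφ).const_smul _), withDensity_smul _ (hf.comp hφ),
      withDensity_smul _ (hg.comp hφ), ← hl₁d, ← hl₂d] at this
    exact this.symm
  apply Subtype.ext
  change (m₁ : Measure (T → B)) = (μ : Measure (T → A)).map φ
  rw [← hl₁m, hl]

end Factors

/-! ### Measures that agree at most coordinates -/

section Closeness

variable {T K : Type*}

/-- Evaluate every coordinate of a configuration of pairs by `Prod.fst`. -/
noncomputable def fstMap (ω : T → K × K) : T → K := fun t => (ω t).1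

/-- Evaluate every coordinate of a configuration of pairs by `Prod.snd`. -/
noncomputable def sndMap (ω : T → K × K) : T → K := fun t => (ω t).2

open Classical in
/-- The second entries on the coordinates in `s`, the first entries elsewhere. -/
noncomputable def mixMap (s : Set T) (ω : T → K × K) : T → K :=
  fun t => if t ∈ s then (ω t).2 else (ω t).1

theorem mixMap_of_mem {s : Set T} {t : T} (ht : t ∈ s) (ω : T → K × K) :
    mixMap s ω t = (ω t).2 := if_pos ht

theorem mixMap_of_notMem {s : Set T} {t : T} (ht : t ∉ s) (ω : T → K × K) :
    mixMap s ω t = (ω t).1 := if_neg ht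

variable [MetricSpace K]

theorem continuous_fstMap : Continuous (fstMap : (T → K × K) → T → K) := by
  unfold fstMap; fun_prop

theorem continuous_sndMap : Continuous (sndMap : (T → K × K) → T → K) := by
  unfold sndMap; fun_prop

theorem continuous_mixMap (s : Set T) : Continuous (mixMap s : (T → K × K) → T → K) := by
  refine continuous_pi fun t => ?_
  by_cases ht : t ∈ s
  · simpa [mixMap, ht] using (continuous_apply t).snd
  · simpa [mixMap, ht] using (continuous_apply t).fst

variable [CompactSpace K]

/-- A continuous function on the compact product is uniformly continuous, and an entourage of the
product restricts only finitely many coordinates. -/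
theorem exists_finset_forall_eq_dist_lt (f : C(T → K, ℝ)) {δ : ℝ} (hδ : 0 < δ) :
    ∃ s : Finset T, ∀ x y : T → K, (∀ t ∈ s, x t = y t) → dist (f x) (f y) < δ := by
  have huc := CompactSpace.uniformContinuous_of_continuous f.continuous
  have hmem := huc (Metric.dist_mem_uniformity hδ)
  rw [Filter.mem_map, Pi.uniformity, Filter.mem_iInf] at hmem
  obtain ⟨I, hI, V, hV, hVeq⟩ := hmem
  refine ⟨hI.toFinset, fun x y hxy => ?_⟩
  have : (x, y) ∈ ⋂ i, V i := by
    refine mem_iInter.2 fun i => ?_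
    obtain ⟨W, hW, hWV⟩ := Filter.mem_comap.1 (hV i)
    apply hWV
    simpa [hxy i (hI.mem_toFinset.2 i.2)] using refl_mem_uniformity hW
  rwa [← hVeq] at this

variable [Countable T] [MeasurableSpace K] [BorelSpace K]

/-- Off the event that one of finitely many coordinates differs, the integrands are within
$\delta/2$; on it they differ by at most $2\|f\|$, and a union bound controls its mass. -/
theorem exists_forall_dist_integral_le {Y : Type*} [MeasurableSpace Y] (f : C(T → K, ℝ)) {δ : ℝ}
    (hδ : 0 < δ) :
    ∃ ε : ℝ≥0, 0 < ε ∧ ∀ (l : ProbabilityMeasure Y) (φ ψ : Y → T → K),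
      Measurable φ → Measurable ψ →
      (∀ t, (l : Measure Y) {y | φ y t ≠ ψ y t} ≤ ε) →
      dist (∫ x, f x ∂(l : Measure Y).map φ) (∫ x, f x ∂(l : Measure Y).map ψ) ≤ δ := by
  obtain ⟨s, hs⟩ := exists_finset_forall_eq_dist_lt f (half_pos hδ)
  set C : ℝ := 2 * ‖f‖ with hC
  have hC0 : 0 ≤ C := by positivity
  obtain ⟨ε, hε0, hε⟩ : ∃ ε : ℝ≥0, 0 < ε ∧ s.card * C * ε ≤ δ / 2 := by
    -- The added $1$ keeps the denominator positive when `s` is empty or `f` is zero.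
    refine ⟨Real.toNNReal (δ / 2 / (s.card * C + 1)), Real.toNNReal_pos.2 (by positivity), ?_⟩
    rw [Real.coe_toNNReal _ (by positivity), mul_div_assoc', div_le_iff₀ (by positivity)]
    nlinarith
  refine ⟨ε, hε0, fun l φ ψ hφ hψ h => ?_⟩
  set N : Set Y := ⋃ t ∈ s, {y | φ y t ≠ ψ y t}
  have hNm : MeasurableSet N := by
    refine Finset.measurableSet_biUnion _ fun t _ => ?_
    exact (measurableSet_eq_fun ((measurable_pi_apply t).comp hφ)
      ((measurable_pi_apply t).comp hψ)).compl
  have hNle : (l : Measure Y).real N ≤ s.card * ε := by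
    have h1 : (l : Measure Y) N ≤ s.card * ε := by
      refine (measure_biUnion_finset_le _ _).trans ((Finset.sum_le_sum fun t _ => h t).trans ?_)
      simp
    have := ENNReal.toReal_mono (by finiteness) h1
    simpa [Measure.real] using this
  have hint : ∀ θ : Y → T → K, Measurable θ → Integrable (fun y => f (θ y)) (l : Measure Y) := by
    intro θ hθ
    refine Integrable.of_bound (f.continuous.measurable.comp hθ).aestronglyMeasurable ‖f‖ ?_
    exact .of_forall fun y => f.norm_coe_le_norm _
  have hfm : ∀ ν : Measure (T → K), AEStronglyMeasurable f ν := fun ν =>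
    f.continuous.measurable.aestronglyMeasurable
  rw [integral_map hφ.aemeasurable (hfm _), integral_map hψ.aemeasurable (hfm _), dist_eq_norm,
    ← integral_sub (hint φ hφ) (hint ψ hψ)]
  have hbound : ∀ y, ‖f (φ y) - f (ψ y)‖ ≤ δ / 2 + N.indicator (fun _ => C) y := by
    intro y
    by_cases hy : y ∈ N
    · rw [indicator_of_mem hy]
      have := norm_sub_le (f (φ y)) (f (ψ y))
      have h1 := f.norm_coe_le_norm (φ y)
      have h2 := f.norm_coe_le_norm (ψ y)
      linarith
    · rw [indicator_of_notMem hy, add_zero, ← dist_eq_norm]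
      refine (hs _ _ fun t ht => ?_).le
      by_contra hne
      exact hy (mem_biUnion ht hne)
  calc ‖∫ y, f (φ y) - f (ψ y) ∂(l : Measure Y)‖
      ≤ ∫ y, (δ / 2 + N.indicator (fun _ => C) y) ∂(l : Measure Y) := by
        refine norm_integral_le_of_norm_le ?_ (.of_forall hbound)
        exact (integrable_const _).add ((integrable_const C).indicator hNm)
    _ = δ / 2 + (l : Measure Y).real N * C := by
        rw [integral_add (integrable_const _) ((integrable_const C).indicator hNm),
          integral_indicator_const _ hNm]
        simp
    _ ≤ δ := by nlinarith

end Closeness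

/-! ### Joinings with an extreme measure -/

section Joinings

variable {T : Type*} {Γ : Subgroup (Equiv.Perm T)}

theorem fstMap_comp_shift {K : Type*} (γ : Equiv.Perm T) :
    (fstMap ∘ shift γ : (T → K × K) → T → K) = shift γ ∘ fstMap := rfl

theorem sndMap_comp_shift {K : Type*} (γ : Equiv.Perm T) :
    (sndMap ∘ shift γ : (T → K × K) → T → K) = shift γ ∘ sndMap := rfl

theorem mixMap_orbit_comp_shift {K : Type*} (v : T) {γ : Equiv.Perm T} (hγ : γ ∈ Γ) :
    (mixMap (MulAction.orbit Γ v) ∘ shift γ : (T → K × K) → T → K) =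
      shift γ ∘ mixMap (MulAction.orbit Γ v) := by
  funext ω t
  have h : γ t ∈ MulAction.orbit Γ v ↔ t ∈ MulAction.orbit Γ v := by
    change (⟨γ, hγ⟩ : Γ) • t ∈ MulAction.orbit Γ v ↔ _
    rw [MulAction.mem_orbit_symm, MulAction.orbit_smul, MulAction.mem_orbit_symm]
  by_cases ht : t ∈ MulAction.orbit Γ v
  · exact (mixMap_of_mem ht _).trans (mixMap_of_mem (h.2 ht) ω).symm
  · exact (mixMap_of_notMem ht _).trans (mixMap_of_notMem (mt h.1 ht) ω).symm

theorem measure_coord_eq_of_mem_orbit {A : Type*} [MeasurableSpace A]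
    {l : ProbabilityMeasure (T → A)} (hl : l ∈ exchMeasures Γ A) {s : Set A}
    (hs : MeasurableSet s) {v t : T} (ht : t ∈ MulAction.orbit Γ v) :
    (l : Measure (T → A)) {ω | ω t ∈ s} = (l : Measure (T → A)) {ω | ω v ∈ s} := by
  obtain ⟨γ, rfl⟩ := ht
  conv_rhs => rw [← hl γ.1 γ.2]
  exact (Measure.map_apply (measurable_shift _) (measurable_pi_apply v hs)).symm

variable [Countable T] {K : Type*} [MetricSpace K] [CompactSpace K] [MeasurableSpace K]
  [BorelSpace K] {Ω : Set (T → K)}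

omit [Countable T] [MetricSpace K] [CompactSpace K] [BorelSpace K] in
theorem isMixtureFace_exchMeasuresOn :
    IsMixtureFace (exchMeasures Γ K) (exchMeasuresOn Γ Ω) := by
  refine ⟨fun μ hμ => hμ.1, fun m₁ h₁ m₂ h₂ μ hμ a b hm => ⟨h₁, ?_⟩⟩
  exact le_antisymm prob_le_one (hm.le_left_apply hμ.2.ge prob_le_one)

theorem isCompact_exchMeasuresOn (hΩ : IsClosed Ω) (hc : IsCompact (exchMeasures Γ K)) :
    IsCompact (exchMeasuresOn Γ Ω) := by
  convert hc.inter_right (isClosed_setOf_le_measure hΩ 1) using 1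
  ext μ
  exact and_congr_right fun _ => ⟨fun h => h.ge, fun h => le_antisymm prob_le_one h⟩

/-- If an extreme measure is `ε`-close to a measure on `Ω`, then it can be joined to a measure on
`Ω` by an extreme measure, so that the entries at `v` differ with probability less than `ε`. -/
theorem exists_extreme_joining (hc : IsCompact (exchMeasures Γ (K × K))) (hΩ : IsClosed Ω)
    {v : T} {ε : ℝ≥0∞} {μ : ProbabilityMeasure (T → K)}
    (hμ : μ ∈ extremeMeasures (exchMeasures Γ K))
    (hμε : μ ∈ dbarNhd Γ v (exchMeasuresOn Γ Ω) ε) :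
    ∃ l ∈ extremeMeasures (exchMeasures Γ (K × K)),
      (l : Measure (T → K × K)).map fstMap = μ ∧
      (l : Measure (T → K × K)) (sndMap ⁻¹' Ω) = 1 ∧
      (l : Measure (T → K × K)) {ω | (ω v).1 ≠ (ω v).2} < ε := by
  obtain ⟨-, ν, hν, hd⟩ := hμε
  simp only [dbar, iInf_lt_iff] at hd
  obtain ⟨j, ⟨hjinv, hjfst, hjsnd⟩, hjε⟩ := hd
  have hfst : Measurable (fstMap : (T → K × K) → T → K) := continuous_fstMap.measurable
  have hsnd : Measurable (sndMap : (T → K × K) → T → K) := continuous_sndMap.measurable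
  set zip : (T → K) × (T → K) → T → K × K := fun p t => (p.1 t, p.2 t)
  have hzipm : Measurable zip := by
    refine measurable_pi_lambda _ fun t => ?_
    exact ((measurable_pi_apply t).comp measurable_fst).prodMk
      ((measurable_pi_apply t).comp measurable_snd)
  have hDclosed : IsClosed {ω : T → K × K | (ω v).1 = (ω v).2} :=
    isClosed_eq (continuous_apply v).fst (continuous_apply v).snd
  -- The joinings of `μ` with measures on `Ω`. The marginal condition defines a face because `μ` is
  -- extreme, the mass condition because $1$ is the largest possible mass.
  set L : Set (ProbabilityMeasure (T → K × K)) :=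
    exchMeasures Γ (K × K) ∩ ({l | l.map hfst.aemeasurable = μ} ∩
      {l | 1 ≤ (l : Measure (T → K × K)) (sndMap ⁻¹' Ω)})
  have hLc : IsCompact L := by
    refine hc.inter_right (IsClosed.inter ?_ (isClosed_setOf_le_measure
      (hΩ.preimage continuous_sndMap) 1))
    exact isClosed_eq (ProbabilityMeasure.continuous_map continuous_fstMap) continuous_const
  have hLface : IsMixtureFace (exchMeasures Γ (K × K)) L := by
    refine ⟨fun l hl => hl.1, fun m₁ h₁ m₂ h₂ l hl a b hm => ⟨h₁, ?_, ?_⟩⟩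
    · have hmap := hm.map hfst
      rw [show l.map hfst.aemeasurable = μ from hl.2.1] at hmap
      exact hμ.2 _ (map_mem_exchMeasures h₁ hfst fun γ _ => fstMap_comp_shift γ) _
        (map_mem_exchMeasures h₂ hfst fun γ _ => fstMap_comp_shift γ) a b hmap
    · exact hm.le_left_apply hl.2.2 prob_le_one
  have hjL : j.map hzipm.aemeasurable ∈ L := by
    refine ⟨fun γ hγ => ?_, ?_, ?_⟩
    · rw [ProbabilityMeasure.toMeasure_map, Measure.map_map (measurable_shift γ) hzipm]
      conv_rhs => rw [← hjinv γ hγ]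
      rw [Measure.map_map hzipm ((measurable_shift γ).prodMap (measurable_shift γ))]
      rfl
    · refine Subtype.ext ?_
      change ((j : Measure ((T → K) × (T → K))).map zip).map fstMap = μ
      rw [Measure.map_map hfst hzipm, ← hjfst]
      rfl
    · change 1 ≤ ((j : Measure ((T → K) × (T → K))).map zip) (sndMap ⁻¹' Ω)
      rw [← Measure.map_apply hsnd hΩ.measurableSet, Measure.map_map hsnd hzipm]
      change 1 ≤ ((j : Measure ((T → K) × (T → K))).map Prod.snd) Ω
      rw [hjsnd, hν.2]
  -- Agreement at `v` is a closed event, so its probability attains its maximum over `L` at an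
  -- extreme measure, whose mismatch is at most that of `j`.
  obtain ⟨l, ⟨hlext, hlL⟩, hmax⟩ := exists_extremeMeasure_forall_apply_le hLface hLc ⟨_, hjL⟩
    hDclosed
  refine ⟨l, hlext, congrArg Subtype.val hlL.2.1, le_antisymm prob_le_one hlL.2.2, ?_⟩
  have hcompl : ∀ m : ProbabilityMeasure (T → K × K),
      (m : Measure (T → K × K)) {ω | (ω v).1 ≠ (ω v).2} =
        1 - (m : Measure (T → K × K)) {ω | (ω v).1 = (ω v).2} :=
    fun m => prob_compl_eq_one_sub hDclosed.measurableSet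
  refine lt_of_le_of_lt ?_ hjε
  have hj : (j : Measure ((T → K) × (T → K))) {p | p.1 v ≠ p.2 v} =
      (j.map hzipm.aemeasurable : Measure (T → K × K)) {ω | (ω v).1 ≠ (ω v).2} := by
    exact (Measure.map_apply hzipm hDclosed.measurableSet.compl).symm
  rw [hj, hcompl, hcompl]
  exact tsub_le_tsub_left (hmax _ hjL) 1

/-- The two maps agree on the orbit of `v`, so their joint image is a joining without mismatch at
`v`. -/
theorem dbar_mixMap_sndMap {l : ProbabilityMeasure (T → K × K)}
    (hl : l ∈ exchMeasures Γ (K × K)) (v : T) :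
    dbar Γ v
      (l.map (continuous_mixMap (K := K) (MulAction.orbit Γ v)).measurable.aemeasurable)
      (l.map (continuous_sndMap (K := K)).measurable.aemeasurable) = 0 := by
  have hmix := (continuous_mixMap (K := K) (MulAction.orbit Γ v)).measurable
  have hsnd := (continuous_sndMap (T := T) (K := K)).measurable
  have hpair := hmix.prodMk hsnd
  refine nonpos_iff_eq_zero.1 ((iInf₂_le (l.map hpair.aemeasurable) ⟨fun γ hγ => ?_, ?_, ?_⟩).trans
    ?_)
  · have hm : MeasurableSet {p : (T → K) × (T → K) | p.1 v ≠ p.2 v} :=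
      (measurableSet_eq_fun ((measurable_pi_apply v).comp measurable_fst)
        ((measurable_pi_apply v).comp measurable_snd)).compl
    rw [ProbabilityMeasure.toMeasure_map, Measure.map_apply hpair hm]
    simp [mixMap, sndMap, MulAction.mem_orbit_self]
  · rw [ProbabilityMeasure.toMeasure_map,
      Measure.map_map ((measurable_shift γ).prodMap (measurable_shift γ)) hpair]
    conv_rhs => rw [← hl γ hγ, Measure.map_map hpair (measurable_shift γ)]
    congr 1
    funext ω
    exact Prod.ext (congrFun (mixMap_orbit_comp_shift v hγ) ω).symm rfl
  · rw [ProbabilityMeasure.toMeasure_map, Measure.map_map measurable_fst hpair]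
    rfl
  · rw [ProbabilityMeasure.toMeasure_map, Measure.map_map measurable_snd hpair]
    rfl

/-- Otherwise the complement of the point `μ` would be a vague neighbourhood of the measures on `Ω`,
hence would contain a d-bar neighbourhood, to which `μ` belongs. -/
theorem mem_exchMeasuresOn_of_forall_mem_dbarNhd {v : T}
    (hbases : NhdBasesEquivalent Γ v (exchMeasuresOn Γ Ω)) {μ : ProbabilityMeasure (T → K)}
    (hμ : ∀ ε : ℝ≥0∞, 0 < ε → μ ∈ dbarNhd Γ v (exchMeasuresOn Γ Ω) ε) :
    μ ∈ exchMeasuresOn Γ Ω := by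
  by_contra h
  obtain ⟨ε, hε, hsub⟩ := hbases.1 {μ}ᶜ isOpen_compl_singleton (subset_compl_singleton_iff.2 h)
  exact hsub (hμ ε hε) rfl

/-- An extreme measure that is `ε`-close to the measures on `Ω` is coupled to an extreme measure
on `Ω`, so that the entries at each coordinate differ with probability at most `ε`. -/
theorem exists_extreme_coupling (hc : IsCompact (exchMeasures Γ (K × K))) (hΩ : IsClosed Ω)
    {v : T} (hbases : NhdBasesEquivalent Γ v (exchMeasuresOn Γ Ω)) {ε : ℝ≥0∞}
    {μ : ProbabilityMeasure (T → K)} (hμ : μ ∈ extremeMeasures (exchMeasures Γ K))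
    (hμε : μ ∈ dbarNhd Γ v (exchMeasuresOn Γ Ω) ε) :
    ∃ ν ∈ extremeMeasures (exchMeasuresOn Γ Ω), ∃ l : ProbabilityMeasure (T → K × K),
      ∃ φ ψ : (T → K × K) → T → K, Measurable φ ∧ Measurable ψ ∧
        (l : Measure (T → K × K)).map φ = μ ∧ (l : Measure (T → K × K)).map ψ = ν ∧
        ∀ t, (l : Measure (T → K × K)) {ω | φ ω t ≠ ψ ω t} ≤ ε := by
  obtain ⟨l, hl, hlfst, hlΩ, hlε⟩ := exists_extreme_joining hc hΩ hμ hμε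
  have hmix := (continuous_mixMap (K := K) (MulAction.orbit Γ v)).measurable
  have hsnd := (continuous_sndMap (T := T) (K := K)).measurable
  have hν := map_mem_extremeMeasures hl hmix fun γ hγ => mixMap_orbit_comp_shift v hγ
  have hsndΩ : l.map hsnd.aemeasurable ∈ exchMeasuresOn Γ Ω := by
    refine ⟨map_mem_exchMeasures hl.1 hsnd fun γ _ => sndMap_comp_shift γ, ?_⟩
    rw [ProbabilityMeasure.toMeasure_map, Measure.map_apply hsnd hΩ.measurableSet, hlΩ]
  have hνΩ : l.map hmix.aemeasurable ∈ exchMeasuresOn Γ Ω :=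
    mem_exchMeasuresOn_of_forall_mem_dbarNhd hbases fun δ hδ =>
      ⟨hν.1, _, hsndΩ, by rwa [dbar_mixMap_sndMap hl.1 v]⟩
  refine ⟨_, extremeMeasures_inter_subset isMixtureFace_exchMeasuresOn.subset ⟨hν, hνΩ⟩, l,
    fstMap, mixMap (MulAction.orbit Γ v), continuous_fstMap.measurable, hmix, hlfst, rfl,
    fun t => ?_⟩
  -- Invariance carries the mismatch bound at `v` along its orbit; elsewhere the two maps coincide.
  by_cases ht : t ∈ MulAction.orbit Γ v
  · have hs : MeasurableSet {p : K × K | p.1 ≠ p.2} :=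
      (measurableSet_eq_fun measurable_fst measurable_snd).compl
    have := measure_coord_eq_of_mem_orbit hl.1 hs ht
    simp only [mem_ofPred_eq] at this
    simpa [fstMap, mixMap, ht, this] using hlε.le
  · simp [fstMap, mixMap, ht]

theorem exchMeasuresOn_subset_closure_extremeMeasures
    (hc : IsCompact (exchMeasures Γ (K × K))) (hΩ : IsClosed Ω) {v : T}
    (hbases : NhdBasesEquivalent Γ v (exchMeasuresOn Γ Ω))
    (hdense : exchMeasures Γ K ⊆ closure (extremeMeasures (exchMeasures Γ K))) :
    exchMeasuresOn Γ Ω ⊆ closure (extremeMeasures (exchMeasuresOn Γ Ω)) := by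
  intro μ hμ
  obtain ⟨B, hB⟩ := (𝓝 μ).exists_antitone_basis
  have hstep : ∀ n : ℕ, ∃ m ∈ B n, ∃ ν ∈ extremeMeasures (exchMeasuresOn Γ Ω),
      ∃ l : ProbabilityMeasure (T → K × K), ∃ φ ψ : (T → K × K) → T → K,
        Measurable φ ∧ Measurable ψ ∧
        (l : Measure (T → K × K)).map φ = m ∧ (l : Measure (T → K × K)).map ψ = ν ∧
        ∀ t, (l : Measure (T → K × K)) {ω | φ ω t ≠ ψ ω t} ≤ (n : ℝ≥0∞)⁻¹ := by
    intro n
    -- At $n = 0$ the radius is $\infty$, which is harmless: only positivity is needed here.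
    obtain ⟨U, hUo, hSU, hU⟩ := hbases.2 (n : ℝ≥0∞)⁻¹ (by simp)
    obtain ⟨m, ⟨hmB, hmU⟩, hm⟩ := mem_closure_iff_nhds.1 (hdense hμ.1) _
      (Filter.inter_mem (hB.1.mem_of_mem trivial) (hUo.mem_nhds (hSU hμ)))
    exact ⟨m, hmB, exists_extreme_coupling hc hΩ hbases hm (hU ⟨hmU, hm.1⟩)⟩
  choose m hmB ν hν l φ ψ hφ hψ hlm hlν hl using hstep
  have hm : Filter.Tendsto m Filter.atTop (𝓝 μ) := hB.tendsto hmB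
  refine mem_closure_of_tendsto (f := ν) (b := Filter.atTop) ?_ (.of_forall hν)
  rw [ProbabilityMeasure.tendsto_iff_forall_integral_tendsto] at hm ⊢
  intro f
  refine (hm f).congr_dist ?_
  rw [Metric.tendsto_atTop]
  intro δ hδ
  obtain ⟨ε, hε, hdist⟩ := exists_forall_dist_integral_le (Y := T → K × K) f.toContinuousMap
    (half_pos hδ)
  obtain ⟨N, hN⟩ := ENNReal.exists_inv_nat_lt (ENNReal.coe_ne_zero.2 hε.ne')
  refine ⟨N, fun n hn => ?_⟩
  have := hdist (l n) (φ n) (ψ n) (hφ n) (hψ n) fun t =>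
    (hl n t).trans ((ENNReal.inv_le_inv.2 (by exact_mod_cast hn)).trans hN.le)
  rw [hlm, hlν] at this
  rw [Real.dist_0_eq_abs, abs_of_nonneg dist_nonneg]
  exact lt_of_le_of_lt this (half_lt_self hδ)

theorem convex_toFunctional_image_exchMeasuresOn
    (hconv : Convex ℝ (toFunctional '' exchMeasures Γ K)) :
    Convex ℝ (toFunctional '' exchMeasuresOn Γ Ω) := by
  rw [convex_iff_openSegment_subset] at hconv ⊢
  rintro _ ⟨m₁, h₁, rfl⟩ _ ⟨m₂, h₂, rfl⟩ x hx
  obtain ⟨μ, hμ, rfl⟩ := hconv (mem_image_of_mem _ h₁.1) (mem_image_of_mem _ h₂.1) hx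
  obtain ⟨a, b, hm⟩ := mem_openSegment_toFunctional_iff.1 hx
  refine mem_image_of_mem _ ⟨hμ, ?_⟩
  rw [hm.eq_add, Measure.add_apply, Measure.smul_apply, Measure.smul_apply, h₁.2, h₂.2]
  simp only [ENNReal.smul_def, smul_eq_mul, mul_one]
  exact_mod_cast hm.add_eq_one

end Joinings

theorem proposition5p1 {T : Type w} [Countable T] [Infinite T]
    (Γ : Subgroup (Equiv.Perm T))
    (hΓ : ∀ t : T, (MulAction.orbit Γ t).Infinite)
    (hPoulsen : HasPoulsenProperty.{u, w} Γ)
    {K : Type u} [MetricSpace K] [CompactSpace K] [MeasurableSpace K] [BorelSpace K]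
    (Ω : Set (T → K)) (hΩ_closed : IsClosed Ω)
    (hΩ_inv : ∀ γ ∈ Γ, ∀ ω ∈ Ω, shift γ ω ∈ Ω)
    (hΩ_nontrivial : (exchMeasuresOn Γ Ω).Nontrivial)
    (v : T) (hbases : NhdBasesEquivalent Γ v (exchMeasuresOn Γ Ω)) :
    IsPoulsenSimplex (toFunctional '' exchMeasuresOn Γ Ω) := by
  -- Over a `K` with at most one point, $K^T$ carries at most one probability measure. The Poulsen
  -- property can thus be applied to `K` and `K × K`.
  have hK : Nontrivial K := by
    by_contra h
    rw [not_nontrivial_iff_subsingleton] at h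
    obtain ⟨μ, -, ν, -, hne⟩ := hΩ_nontrivial
    refine hne (Subtype.ext (Measure.ext fun s _ => ?_))
    rcases s.eq_empty_or_nonempty with rfl | hs
    · simp
    · rw [Subsingleton.eq_univ_of_nonempty hs]
      exact (measure_univ (μ := (μ : Measure (T → K)))).trans
        (measure_univ (μ := (ν : Measure (T → K)))).symm
  have hPK := hPoulsen K
  have hcKK : IsCompact (exchMeasures Γ (K × K)) :=
    isInducing_toFunctional.isCompact_iff.2 (hPoulsen (K × K)).simplex.isCompact
  have hcK : IsCompact (exchMeasures Γ K) :=
    isInducing_toFunctional.isCompact_iff.2 hPK.simplex.isCompact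
  have hdense : exchMeasures Γ K ⊆ closure (extremeMeasures (exchMeasures Γ K)) := by
    have := hPK.dense_extremePoints
    rw [extremePoints_toFunctional_image] at this
    rw [isInducing_toFunctional.closure_eq_preimage_closure_image]
    exact image_subset_iff.1 this
  have hsub : toFunctional '' exchMeasuresOn Γ Ω ⊆ toFunctional '' exchMeasures Γ K :=
    image_mono fun _ hμ => hμ.1
  refine ⟨hΩ_nontrivial.image toFunctional_injective, ?_, ?_, ?_⟩
  · have := hPK.metrizable
    exact (IsEmbedding.inclusion hsub).metrizableSpace
  · exact hPK.simplex.of_isExtreme isMixtureFace_exchMeasuresOn.isExtreme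
      (isInducing_toFunctional.isCompact_iff.1 (isCompact_exchMeasuresOn hΩ_closed hcK))
      (convex_toFunctional_image_exchMeasuresOn hPK.simplex.convex)
  · rw [extremePoints_toFunctional_image, image_subset_iff,
      ← isInducing_toFunctional.closure_eq_preimage_closure_image]
    exact exchMeasuresOn_subset_closure_extremeMeasures hcKK hΩ_closed hbases hdense
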